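/- Let $n \ge 1$ be an integer, let $I^n = [0,1]^n \subset \mathbb{R}^n$, and let $f \colon I^n \to \mathbb{R}^{n-1}$ be a continuous function (where $\mathbb{R}^0 = \{0\}$). Then there exist a point $p \in \mathbb{R}^{n-1}$ and a compact connected set $S \subset f^{-1}[\{p\}]$ such that, for some $i \in \{1, \dots, n\}$, the set $S$ meets both opposite faces $\{z \in I^n : z_i = 0\}$ and $\{z \in I^n : z_i = 1\}$ of the cube. -/

import Mathlib

/-- The `n`-dimensional unit cube `[0, 1]^n` in `ℝ^n`. -/
def unitCube (n : ℕ) : Set (Fin n → ℝ) :=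
  {z | ∀ i, z i ∈ Set.Icc (0 : ℝ) 1}

/-- The face of the unit cube on which the `i`-th coordinate is `0`. -/
def lowerFace (n : ℕ) (i : Fin n) : Set (Fin n → ℝ) :=
  {z | z ∈ unitCube n ∧ z i = 0}

/-- The face of the unit cube on which the `i`-th coordinate is `1`. -/
def upperFace (n : ℕ) (i : Fin n) : Set (Fin n → ℝ) :=
  {z | z ∈ unitCube n ∧ z i = 1}

/-- `S` is a connected subset of the unit cube that meets both `i`-th opposite faces. -/
def ConnectsFaces (n : ℕ) (i : Fin n) (S : Set (Fin n → ℝ)) : Prop :=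
  S ⊆ unitCube n ∧ IsConnected S ∧
    (S ∩ lowerFace n i).Nonempty ∧ (S ∩ upperFace n i).Nonempty

/-- `S` connects the `i`-th opposite faces of the unit cube for some `i`. -/
def ConnectsSomeFaces (n : ℕ) (S : Set (Fin n → ℝ)) : Prop :=
  ∃ i : Fin n, ConnectsFaces n i S

/-! Suppose no fibre contains such a set. Each compact fibre then splits into clopen pieces, so
every direction `i` has a two-valued function that is 0 and 1 on the opposite faces and locally
constant near the fibre. Compactness of the image makes the scale `δ` uniform
(`exists_faceSeparator_uniform`).

For each of the `n` directions `c`, cut `ℝ^m` into cubes of side `δ`, the grid being shifted by `c *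
δ / n`, and use on the preimage of each cell a separator for direction `c`. At small scale the
resulting function `g c` jumps only where `f` is near a wall of grid `c`. As `m < n`, every point of
`ℝ^m` is far from the walls of some grid (`exists_translate_far_from_integers`), so on each small
cube some `g c` is constant.

This contradicts the discrete Poincaré–Miranda theorem `exists_lattice_cube_forall_ne`, which
follows from Stokes: the mod 2 cup product of the coboundaries of all `g c` sums to 1 over the
lattice box. -/

/-! ### Cubical cup products mod 2 -/

theorem sum_sum_erase_swap {ι M : Type*} [DecidableEq ι] [AddCommMonoid M] (J : Finset ι)
    (a : ι → ι → M) :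
    ∑ j ∈ J, ∑ i ∈ J.erase j, a j i = ∑ j ∈ J, ∑ i ∈ J.erase j, a i j := by
  apply Finset.sum_comm'
  intro x y
  simp only [Finset.mem_erase]
  tauto

theorem sum_sum_erase_eq_zero {ι : Type*} [DecidableEq ι] (J : Finset ι)
    (a : ι → ι → ZMod 2) (ha : ∀ i j, a i j = a j i) :
    ∑ j ∈ J, ∑ i ∈ J.erase j, a j i = 0 := by
  rw [Finset.sum_sigma']
  refine Finset.sum_involution (fun p _ => ⟨p.2, p.1⟩) ?_ ?_ ?_ ?_
  · rintro ⟨i, j⟩ _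
    simp only
    rw [ha j i]
    exact CharTwo.add_self_eq_zero _
  · rintro ⟨i, j⟩ h _ h'
    simp only [Finset.mem_sigma, Finset.mem_erase, Sigma.mk.injEq] at h h'
    exact h.2.1 h'.1
  · rintro ⟨i, j⟩ h
    simp only [Finset.mem_sigma, Finset.mem_erase] at h ⊢
    exact ⟨h.2.2, fun e => h.2.1 e.symm, h.1⟩
  · rintro ⟨i, j⟩ _
    rfl

/-- The cubical cup product `δg₁ ∪ ⋯ ∪ δgₖ` of the coboundaries of the functions in the list,
evaluated on the unit cube with lowest vertex `x` spanned by the directions in `J`. -/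
def cupSum {ι : Type*} [DecidableEq ι] :
    List ((ι → ℕ) → ZMod 2) → Finset ι → (ι → ℕ) → ZMod 2
  | [], _, _ => 1
  | g :: gs, J, x => ∑ j ∈ J, (g (x + Pi.single j 1) + g x) *
      cupSum gs (J.erase j) (x + Pi.single j 1)

section CupSum

variable {ι : Type*} [DecidableEq ι]

/-- The cup product of coboundaries is closed. -/
theorem sum_cupSum_add_cupSum (gs : List ((ι → ℕ) → ZMod 2)) (J : Finset ι) (x : ι → ℕ) :
    ∑ j ∈ J, (cupSum gs (J.erase j) (x + Pi.single j 1) + cupSum gs (J.erase j) x) = 0 := by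
  induction gs generalizing J x with
  | nil =>
    simp only [cupSum]
    exact Finset.sum_eq_zero fun _ _ => CharTwo.add_self_eq_zero _
  | cons g gs ih =>
    simp only [cupSum]
    have comm : ∀ i j, x + Pi.single i 1 + Pi.single j 1 = x + Pi.single j 1 + Pi.single i 1 :=
      fun i j => add_right_comm _ _ _
    have ecomm : ∀ i j, (J.erase i).erase j = (J.erase j).erase i :=
      fun i j => Finset.erase_right_comm
    have h1 := sum_sum_erase_eq_zero J (fun j i => g (x + Pi.single j 1 + Pi.single i 1) *
      cupSum gs ((J.erase j).erase i) (x + Pi.single j 1 + Pi.single i 1))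
      (fun i j => by rw [comm, ecomm])
    -- The shorter product is closed on the cubes spanned by `J.erase j`, based at `x + Pi.single j
    -- 1` here and at `x` in `h3`.
    have h2 : ∑ j ∈ J, ∑ i ∈ J.erase j, g (x + Pi.single j 1) *
        (cupSum gs ((J.erase j).erase i) (x + Pi.single j 1 + Pi.single i 1) +
          cupSum gs ((J.erase j).erase i) (x + Pi.single j 1)) = 0 :=
      Finset.sum_eq_zero fun j _ => by rw [← Finset.mul_sum, ih, mul_zero]
    have h3 : ∑ j ∈ J, ∑ i ∈ J.erase j, g x *
        (cupSum gs ((J.erase j).erase i) (x + Pi.single i 1) +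
          cupSum gs ((J.erase j).erase i) x) = 0 :=
      Finset.sum_eq_zero fun j _ => by rw [← Finset.mul_sum, ih, mul_zero]
    have h4 := sum_sum_erase_eq_zero J (fun j i => g x * cupSum gs ((J.erase j).erase i) x)
      (fun i j => by rw [ecomm])
    have h5 : ∑ j ∈ J, ∑ i ∈ J.erase j, g (x + Pi.single j 1) *
          cupSum gs ((J.erase j).erase i) (x + Pi.single j 1) =
        ∑ j ∈ J, ∑ i ∈ J.erase j, g (x + Pi.single i 1) *
          cupSum gs ((J.erase j).erase i) (x + Pi.single i 1) := by
      rw [sum_sum_erase_swap]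
      simp only [ecomm]
    simp only [add_mul, mul_add, Finset.sum_add_distrib] at h1 h2 h3 h4 h5 ⊢
    rw [h1, ← h5]
    rw [h4] at h3
    linear_combination h2 + h3

/-- `δg ∪ δg₁ ∪ ⋯ ∪ δgₖ` is the coboundary of `g ∪ δg₁ ∪ ⋯ ∪ δgₖ`. -/
theorem cupSum_cons_eq (g : (ι → ℕ) → ZMod 2) (gs : List ((ι → ℕ) → ZMod 2)) (J : Finset ι)
    (x : ι → ℕ) :
    cupSum (g :: gs) J x = ∑ j ∈ J, (g (x + Pi.single j 1) *
      cupSum gs (J.erase j) (x + Pi.single j 1) + g x * cupSum gs (J.erase j) x) := by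
  have h := congrArg (g x * ·) (sum_cupSum_add_cupSum gs J x)
  simp only [mul_zero, Finset.mul_sum] at h
  rw [cupSum, ← add_zero (Finset.sum _ _), ← h, ← Finset.sum_add_distrib]
  refine Finset.sum_congr rfl fun j _ => ?_
  have h2 := CharTwo.add_self_eq_zero (g x * cupSum gs (J.erase j) (x + Pi.single j 1))
  linear_combination h2

/-- Inside a face orthogonal to `i` at either end, `g i` is constant, so its coboundary kills the
product. -/
theorem cupSum_eq_zero_of_mem {M : ℕ} {g : ι → (ι → ℕ) → ZMod 2}
    (h0 : ∀ i x, x i = 0 → g i x = 0) (h1 : ∀ i x, x i = M → g i x = 1) {i : ι}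
    (l : List ι) (hl : i ∈ l) (J : Finset ι) (hJ : i ∉ J) (x : ι → ℕ)
    (hx : x i = 0 ∨ x i = M) : cupSum (l.map g) J x = 0 := by
  induction l generalizing J x with
  | nil => simp at hl
  | cons k l ih =>
    rw [List.map_cons, cupSum]
    refine Finset.sum_eq_zero fun j hj => ?_
    have hij : i ≠ j := fun h => hJ (h ▸ hj)
    have hxj : (x + Pi.single j 1 : ι → ℕ) i = x i := by simp [hij]
    rcases eq_or_ne i k with rfl | hik
    · have : g i (x + Pi.single j 1) = g i x := by
        rcases hx with hx | hx
        · rw [h0 i x hx, h0 _ _ (hxj.trans hx)]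
        · rw [h1 i x hx, h1 _ _ (hxj.trans hx)]
      rw [this, CharTwo.add_self_eq_zero, zero_mul]
    · rw [ih (List.mem_of_ne_of_mem hik hl) _ (fun h => hJ (Finset.mem_of_mem_erase h)) _
        (by rwa [hxj]), mul_zero]

theorem exists_ne_of_cupSum_ne_zero (g : ι → (ι → ℕ) → ZMod 2) (l : List ι) (J : Finset ι)
    (x : ι → ℕ) (h : cupSum (l.map g) J x ≠ 0) :
    ∀ i ∈ l, ∃ y z : ι → ℕ, (∀ k, x k ≤ y k ∧ y k ≤ x k + 1) ∧
      (∀ k, x k ≤ z k ∧ z k ≤ x k + 1) ∧ g i y ≠ g i z := by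
  -- Restricting to directions in `J` makes the induction work: each step removes its direction, so
  -- no coordinate grows twice.
  suffices H : ∀ i ∈ l, ∃ y z : ι → ℕ,
      (∀ k, x k ≤ y k ∧ y k ≤ x k + if k ∈ J then 1 else 0) ∧
      (∀ k, x k ≤ z k ∧ z k ≤ x k + if k ∈ J then 1 else 0) ∧ g i y ≠ g i z by
    intro i hi
    obtain ⟨y, z, hy, hz, hyz⟩ := H i hi
    have key : ∀ k, (if k ∈ J then 1 else 0) ≤ 1 := fun k => by split_ifs <;> simp
    exact ⟨y, z, fun k => ⟨(hy k).1, (hy k).2.trans (by have := key k; omega)⟩,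
      fun k => ⟨(hz k).1, (hz k).2.trans (by have := key k; omega)⟩, hyz⟩
  induction l generalizing J x with
  | nil => simp
  | cons a l ih =>
    rw [List.map_cons, cupSum] at h
    obtain ⟨j, hj, hne⟩ := Finset.exists_ne_zero_of_sum_ne_zero h
    have hx' : ∀ k, x k ≤ (x + Pi.single j 1 : ι → ℕ) k ∧
        (x + Pi.single j 1 : ι → ℕ) k ≤ x k + if k ∈ J then 1 else 0 := by
      intro k
      rcases eq_or_ne k j with rfl | hk
      · simp [hj]
      · simp [hk]
    have hle : ∀ k, (x + Pi.single j 1 : ι → ℕ) k + (if k ∈ J.erase j then 1 else 0) ≤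
        x k + if k ∈ J then 1 else 0 := by
      intro k
      rcases eq_or_ne k j with rfl | hk
      · simp [hj]
      · simp [hk]
    intro i hi
    rcases List.mem_cons.1 hi with rfl | hi
    · refine ⟨x + Pi.single j 1, x, hx', fun k => ⟨le_rfl, by omega⟩, fun e => ?_⟩
      rw [e, CharTwo.add_self_eq_zero, zero_mul] at hne
      exact hne rfl
    · obtain ⟨y, z, hy, hz, hyz⟩ := ih _ _ (right_ne_zero_of_mul hne) i hi
      exact ⟨y, z, fun k => ⟨(hx' k).1.trans (hy k).1, (hy k).2.trans (hle k)⟩,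
        fun k => ⟨(hx' k).1.trans (hz k).1, (hz k).2.trans (hle k)⟩, hyz⟩

end CupSum

/-! ### Stokes on the lattice box and discrete Poincaré–Miranda -/

/-- The lattice points whose coordinates in `J` are less than `M` and whose other coordinates
are those of `c`. -/
def latticeBox {ι : Type*} [DecidableEq ι] [Fintype ι] (M : ℕ) (J : Finset ι) (c : ι → ℕ) :
    Finset (ι → ℕ) :=
  Fintype.piFinset fun i => if i ∈ J then Finset.range M else {c i}

section LatticeBox

variable {ι : Type*} [DecidableEq ι] [Fintype ι]

theorem mem_latticeBox {M : ℕ} {J : Finset ι} {c x : ι → ℕ} :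
    x ∈ latticeBox M J c ↔ ∀ i, (i ∈ J → x i < M) ∧ (i ∉ J → x i = c i) := by
  simp only [latticeBox, Fintype.mem_piFinset]
  refine forall_congr' fun i => ?_
  by_cases h : i ∈ J <;> simp [h]

theorem sum_latticeBox_eq {M : ℕ} {J : Finset ι} {j : ι} (hj : j ∈ J) (c : ι → ℕ)
    (F : (ι → ℕ) → ZMod 2) :
    ∑ x ∈ latticeBox M J c, F x =
      ∑ t ∈ Finset.range M, ∑ x ∈ latticeBox M (J.erase j) (Function.update c j t), F x := by
  rw [← Finset.sum_fiberwise_of_maps_to (g := fun x => x j)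
    (fun x hx => Finset.mem_range.2 ((mem_latticeBox.1 hx j).1 hj))]
  refine Finset.sum_congr rfl fun t ht => Finset.sum_congr ?_ fun _ _ => rfl
  ext x
  rw [Finset.mem_filter, mem_latticeBox, mem_latticeBox]
  rw [Finset.mem_range] at ht
  constructor
  · rintro ⟨h, rfl⟩ i
    rcases eq_or_ne i j with rfl | hij
    · simp
    · simpa [hij] using h i
  · intro h
    have hxj : x j = t := by simpa using (h j).2
    refine ⟨fun i => ?_, hxj⟩
    rcases eq_or_ne i j with rfl | hij
    · simp [hj, hxj, ht]
    · simpa [hij] using h i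

theorem sum_latticeBox_shift {M : ℕ} {J : Finset ι} {j : ι} (hj : j ∉ J) (c : ι → ℕ) (t : ℕ)
    (F : (ι → ℕ) → ZMod 2) :
    ∑ x ∈ latticeBox M J (Function.update c j t), F (x + Pi.single j 1) =
      ∑ x ∈ latticeBox M J (Function.update c j (t + 1)), F x := by
  refine Finset.sum_nbij' (fun x => x + Pi.single j 1) (fun x => x - Pi.single j 1) ?_ ?_ ?_ ?_ ?_
  · intro x hx
    rw [mem_latticeBox] at hx ⊢
    intro i
    rcases eq_or_ne i j with rfl | hij
    · simpa [hj] using hx i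
    · simpa [hij] using hx i
  · intro x hx
    rw [mem_latticeBox] at hx ⊢
    intro i
    rcases eq_or_ne i j with rfl | hij
    · have := (hx i).2 hj
      simp at this
      simp [hj, this]
    · simpa [hij] using hx i
  · intro x _
    simp
  · intro x hx
    rw [mem_latticeBox] at hx
    have := (hx j).2 hj
    simp at this
    ext i
    rcases eq_or_ne i j with rfl | hij
    · simp [this]
    · simp [hij]
  · intro x _
    rfl

theorem sum_latticeBox_telescope {M : ℕ} {J : Finset ι} {j : ι} (hj : j ∈ J) (c : ι → ℕ)
    (F : (ι → ℕ) → ZMod 2) :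
    ∑ x ∈ latticeBox M J c, (F (x + Pi.single j 1) + F x) =
      ∑ x ∈ latticeBox M (J.erase j) (Function.update c j M), F x +
        ∑ x ∈ latticeBox M (J.erase j) (Function.update c j 0), F x := by
  rw [sum_latticeBox_eq hj]
  simp only [Finset.sum_add_distrib, sum_latticeBox_shift (Finset.notMem_erase j J)]
  rw [← Finset.sum_add_distrib]
  simp only [← CharTwo.sub_eq_add]
  exact Finset.sum_range_sub
    (fun t => ∑ x ∈ latticeBox M (J.erase j) (Function.update c j t), F x) M

/-- Stokes reduces the sum to the boundary faces. Only the upper `i`-face survives, `i` being the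
head of the list, and it carries the same sum for the tail. -/
theorem sum_cupSum_latticeBox {M : ℕ} {g : ι → (ι → ℕ) → ZMod 2}
    (h0 : ∀ i x, x i = 0 → g i x = 0) (h1 : ∀ i x, x i = M → g i x = 1)
    (l : List ι) (hl : l.Nodup) (c : ι → ℕ) :
    ∑ x ∈ latticeBox M l.toFinset c, cupSum (l.map g) l.toFinset x = 1 := by
  induction l generalizing c with
  | nil =>
    have : latticeBox M (∅ : Finset ι) c = {c} := by
      ext x
      simp [mem_latticeBox, funext_iff]
    simp [cupSum, this]
  | cons i l ih =>
    obtain ⟨hil, hl⟩ := List.nodup_cons.1 hl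
    have herase : (i :: l).toFinset.erase i = l.toFinset := by
      rw [List.toFinset_cons, Finset.erase_insert (by simpa using hil)]
    have hi : i ∈ (i :: l).toFinset := by simp
    have hface : ∀ {j : ι} {t : ℕ} {x : ι → ℕ},
        x ∈ latticeBox M ((i :: l).toFinset.erase j) (Function.update c j t) → x j = t := by
      intro j t x hx
      simpa using (mem_latticeBox.1 hx j).2 (Finset.notMem_erase _ _)
    simp only [List.map_cons, cupSum_cons_eq]
    rw [Finset.sum_comm]
    rw [Finset.sum_congr rfl fun j hj => sum_latticeBox_telescope hj c
      (fun x => g i x * cupSum (l.map g) ((i :: l).toFinset.erase j) x)]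
    rw [Finset.sum_eq_single_of_mem i hi]
    · rw [Finset.sum_eq_zero (s := latticeBox M _ (Function.update c i 0)), add_zero]
      · rw [← ih hl (Function.update c i M)]
        refine Finset.sum_congr (by rw [herase]) fun x hx => ?_
        rw [herase, h1 i x, one_mul]
        rw [← herase] at hx
        exact hface hx
      · intro x hx
        rw [h0 i x (hface hx), zero_mul]
    · intro j hj hji
      have hjl : j ∈ l := by simpa [hji] using hj
      rw [Finset.sum_eq_zero, Finset.sum_eq_zero, add_zero]
      · intro x hx
        rw [cupSum_eq_zero_of_mem h0 h1 l hjl _ (Finset.notMem_erase _ _) x (Or.inl (hface hx)),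
          mul_zero]
      · intro x hx
        rw [cupSum_eq_zero_of_mem h0 h1 l hjl _ (Finset.notMem_erase _ _) x (Or.inr (hface hx)),
          mul_zero]

/-- A discrete Poincaré–Miranda theorem: if the two-valued function `g i` is `0` on the lattice
hyperplane `x i = 0` and `1` on `x i = M`, then on some unit lattice cube no `g i` is constant. -/
theorem exists_lattice_cube_forall_ne {M : ℕ} {g : ι → (ι → ℕ) → ZMod 2}
    (h0 : ∀ i x, x i = 0 → g i x = 0) (h1 : ∀ i x, x i = M → g i x = 1) :
    ∃ x : ι → ℕ, ∀ i, ∃ y z : ι → ℕ, (∀ k, x k ≤ y k ∧ y k ≤ x k + 1) ∧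
      (∀ k, x k ≤ z k ∧ z k ≤ x k + 1) ∧ g i y ≠ g i z := by
  have h := sum_cupSum_latticeBox h0 h1 Finset.univ.toList (Finset.nodup_toList _) 0
  obtain ⟨x, -, hx⟩ := Finset.exists_ne_zero_of_sum_ne_zero (h.trans_ne one_ne_zero)
  exact ⟨x, fun i => exists_ne_of_cupSum_ne_zero g _ _ x hx i (by simp)⟩

end LatticeBox

/-! ### Separation of closed sets by components -/

/-- In a compact Hausdorff space, two closed sets that no connected component meets
simultaneously are separated by a clopen set. -/
theorem exists_isClopen_of_forall_connectedComponent {X : Type*} [TopologicalSpace X] [T2Space X]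
    [CompactSpace X] {A B : Set X} (hA : IsClosed A) (hB : IsClosed B)
    (h : ∀ a ∈ A, ∀ b ∈ B, connectedComponent a ≠ connectedComponent b) :
    ∃ Z : Set X, IsClopen Z ∧ A ⊆ Z ∧ Disjoint Z B := by
  -- The space of components is compact, Hausdorff and totally disconnected, so clopen sets separate
  -- the disjoint images.
  let q : X → ConnectedComponents X := fun x => x
  have hq : Continuous q := ConnectedComponents.continuous_coe
  have hdisj : q '' A ⊆ (q '' B)ᶜ := by
    rintro _ ⟨a, ha, rfl⟩ ⟨b, hb, hab⟩
    exact h a ha b hb (ConnectedComponents.coe_eq_coe.1 hab).symm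
  obtain ⟨C, hC, hAC, hCB⟩ := exists_clopen_of_closed_subset_open
    (hA.isCompact.image hq).isClosed (hB.isCompact.image hq).isClosed.isOpen_compl hdisj
  refine ⟨q ⁻¹' C, hC.preimage hq, fun a ha => hAC ⟨a, ha, rfl⟩, ?_⟩
  rw [Set.disjoint_left]
  exact fun b hbC hb => hCB hbC ⟨b, hb, rfl⟩

/-- In a compact set containing no compact connected set that meets both `A` and `B`, the traces
of `A` and `B` are contained in complementary compact subsets. -/
theorem IsCompact.exists_compact_separation {X : Type*} [TopologicalSpace X] [T2Space X]
    {K A B : Set X} (hK : IsCompact K) (hA : IsClosed A) (hB : IsClosed B)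
    (h : ∀ S ⊆ K, IsCompact S → IsConnected S → (S ∩ A).Nonempty → ¬ (S ∩ B).Nonempty) :
    ∃ C D : Set X, IsCompact C ∧ IsCompact D ∧ Disjoint C D ∧ C ∪ D = K ∧
      Disjoint C B ∧ Disjoint D A := by
  have : CompactSpace K := isCompact_iff_compactSpace.1 hK
  obtain ⟨Z, hZ, hAZ, hZB⟩ := exists_isClopen_of_forall_connectedComponent
    (hA.preimage (continuous_subtype_val (p := (· ∈ K))))
    (hB.preimage (continuous_subtype_val (p := (· ∈ K)))) (by
      intro a ha b hb hab
      refine h (Subtype.val '' connectedComponent a) (by simp)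
        (isClosed_connectedComponent.isCompact.image continuous_subtype_val)
        (isConnected_connectedComponent.image _ continuous_subtype_val.continuousOn)
        ⟨a, ⟨a, mem_connectedComponent, rfl⟩, ha⟩ ⟨b, ⟨b, ?_, rfl⟩, hb⟩
      rw [hab]
      exact mem_connectedComponent)
  refine ⟨Subtype.val '' Z, Subtype.val '' Zᶜ, hZ.isClosed.isCompact.image continuous_subtype_val,
    hZ.compl.isClosed.isCompact.image continuous_subtype_val,
    (Set.disjoint_image_iff Subtype.val_injective).2 disjoint_compl_right, ?_, ?_, ?_⟩
  · rw [← Set.image_union, Set.union_compl_self, Set.image_univ, Subtype.range_coe]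
  · rw [Set.disjoint_left]
    rintro _ ⟨x, hx, rfl⟩ hxB
    exact Set.disjoint_left.1 hZB hx hxB
  · rw [Set.disjoint_left]
    rintro _ ⟨x, hx, rfl⟩ hxA
    exact hx (hAZ hxA)

/-! ### Separators of opposite faces near a fibre -/

theorem isCompact_unitCube (n : ℕ) : IsCompact (unitCube n) := by
  have : unitCube n = Set.univ.pi fun _ => Set.Icc (0 : ℝ) 1 := by
    ext z
    simp only [unitCube, Set.mem_ofPred_eq, Set.mem_univ_pi]
  rw [this]
  exact isCompact_univ_pi fun _ => isCompact_Icc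

theorem isClosed_lowerFace (n : ℕ) (i : Fin n) : IsClosed (lowerFace n i) :=
  (isCompact_unitCube n).isClosed.inter (isClosed_eq (continuous_apply i) continuous_const)

theorem isClosed_upperFace (n : ℕ) (i : Fin n) : IsClosed (upperFace n i) :=
  (isCompact_unitCube n).isClosed.inter (isClosed_eq (continuous_apply i) continuous_const)

/-- `φ` takes the value `0` on the lower and `1` on the upper `i`-th face of the cube, and is
constant on pairs of `δ`-close points the first of which lies in `s`. -/
structure FaceSeparator {n : ℕ} (i : Fin n) (s : Set (Fin n → ℝ)) (δ : ℝ)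
    (φ : (Fin n → ℝ) → ZMod 2) : Prop where
  lower : ∀ x ∈ lowerFace n i, φ x = 0
  upper : ∀ x ∈ upperFace n i, φ x = 1
  eq_of_dist_lt : ∀ x ∈ s, x ∈ unitCube n → ∀ y ∈ unitCube n, dist x y < δ → φ x = φ y

theorem FaceSeparator.mono {n : ℕ} {i : Fin n} {s t : Set (Fin n → ℝ)} {δ ε : ℝ}
    {φ : (Fin n → ℝ) → ZMod 2} (h : FaceSeparator i s δ φ) (hts : t ⊆ s) (hεδ : ε ≤ δ) :
    FaceSeparator i t ε φ :=
  ⟨h.lower, h.upper, fun x hx hxI y hy hxy => h.eq_of_dist_lt x (hts hx) hxI y hy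
    (hxy.trans_le hεδ)⟩

theorem exists_faceSeparator_empty {n : ℕ} (i : Fin n) (δ : ℝ) :
    ∃ φ, FaceSeparator i ∅ δ φ := by
  classical
  refine ⟨fun x => if x i = 0 then 0 else 1, ⟨fun x hx => by simp [hx.2], fun x hx => by
    simp [hx.2], by simp⟩⟩

section Fibers

variable {n : ℕ} {Y : Type*} [MetricSpace Y] {f : (Fin n → ℝ) → Y}

/-- If no compact connected subset of the fiber over `p` joins the `i`-th faces, then these can
be separated on the preimage of a ball about `p`. -/
theorem exists_faceSeparator_of_fiber (hf : ContinuousOn f (unitCube n)) (p : Y) (i : Fin n)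
    (h : ∀ S ⊆ unitCube n ∩ f ⁻¹' {p}, IsCompact S → ¬ ConnectsFaces n i S) :
    ∃ δ > 0, ∃ φ, FaceSeparator i (f ⁻¹' Metric.ball p δ) δ φ := by
  have hI := isCompact_unitCube n
  have hK : IsCompact (unitCube n ∩ f ⁻¹' {p}) :=
    hI.of_isClosed_subset (hf.preimage_isClosed_of_isClosed hI.isClosed isClosed_singleton)
      Set.inter_subset_left
  obtain ⟨C, D, hC, hD, hCD, hCDK, hCB, hDA⟩ := hK.exists_compact_separation
    (isClosed_lowerFace n i) (isClosed_upperFace n i) (fun S hS hSc hSconn hA hB =>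
      h S hS hSc ⟨hS.trans Set.inter_subset_left, hSconn, hA, hB⟩)
  have hface : Disjoint (lowerFace n i) (upperFace n i) := by
    rw [Set.disjoint_left]
    exact fun x hx hx' => zero_ne_one (hx.2.symm.trans hx'.2)
  obtain ⟨u, hu0, hu1, -⟩ := exists_continuous_zero_one_of_isClosed
    (hC.isClosed.union (isClosed_lowerFace n i)) (hD.isClosed.union (isClosed_upperFace n i))
    (by
      rw [Set.disjoint_union_left, Set.disjoint_union_right, Set.disjoint_union_right]
      exact ⟨⟨hCD, hCB⟩, hDA.symm, hface⟩)
  have huc := hI.uniformContinuousOn_of_continuous u.continuous.continuousOn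
  rw [Metric.uniformContinuousOn_iff] at huc
  obtain ⟨ε, hε, hu⟩ := huc (1 / 4) (by norm_num)
  -- On the fibre `u` is 0 or 1, so this middle band misses it and, by compactness, the preimage of
  -- a ball about `p`.
  have hmid : IsCompact (unitCube n ∩ u ⁻¹' Set.Icc (1 / 4) (3 / 4)) :=
    hI.inter_right (isClosed_Icc.preimage u.continuous)
  have himg : IsClosed (f '' (unitCube n ∩ u ⁻¹' Set.Icc (1 / 4) (3 / 4))) :=
    (hmid.image_of_continuousOn (hf.mono Set.inter_subset_left)).isClosed
  have hp : p ∉ f '' (unitCube n ∩ u ⁻¹' Set.Icc (1 / 4) (3 / 4)) := by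
    rintro ⟨x, ⟨hxI, hx⟩, hxp⟩
    have hxK : x ∈ C ∪ D := hCDK ▸ ⟨hxI, hxp⟩
    rcases hxK with hxC | hxD
    · have : u x = 0 := hu0 (Or.inl hxC)
      rw [Set.mem_preimage, this] at hx
      norm_num at hx
    · have : u x = 1 := hu1 (Or.inl hxD)
      rw [Set.mem_preimage, this] at hx
      norm_num at hx
  obtain ⟨r, hr, hball⟩ := Metric.isOpen_iff.1 himg.isOpen_compl p hp
  classical
  refine ⟨min ε r, lt_min hε hr, fun x => if u x < 1 / 2 then 0 else 1, ?_, ?_, ?_⟩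
  · intro x hx
    have : u x = 0 := hu0 (Or.inr hx)
    simp [this]
  · intro x hx
    have : u x = 1 := hu1 (Or.inr hx)
    rw [if_neg (by rw [this]; norm_num)]
  · intro x hx hxI y hy hxy
    -- `u x` lies outside the band and `u` varies by less than `1 / 4`, so the threshold `1 / 2` is
    -- not crossed.
    have hux : ¬ (1 / 4 ≤ u x ∧ u x ≤ 3 / 4) := fun hux =>
      hball (Metric.ball_subset_ball (min_le_right _ _) hx) ⟨x, ⟨hxI, hux⟩, rfl⟩
    have hd := hu x hxI y hy (hxy.trans_le (min_le_left _ _))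
    rw [Real.dist_eq, abs_lt] at hd
    have : u x < 1 / 2 ↔ u y < 1 / 2 := by
      rcases lt_or_ge (u x) (1 / 4) with h1 | h1
      · exact ⟨fun _ => by linarith, fun _ => by linarith⟩
      · have h2 : 3 / 4 < u x := lt_of_not_ge fun h2 => hux ⟨h1, h2⟩
        exact ⟨fun _ => by linarith, fun _ => by linarith⟩
    simp only [this]

theorem exists_faceSeparator_uniform (hf : ContinuousOn f (unitCube n))
    (h : ∀ p, ∀ S ⊆ unitCube n ∩ f ⁻¹' {p}, IsCompact S → ¬ ConnectsSomeFaces n S) :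
    ∃ δ > 0, ∀ p ∈ f '' unitCube n, ∀ i, ∃ φ, FaceSeparator i (f ⁻¹' Metric.ball p δ) δ φ := by
  refine ((isCompact_unitCube n).image_of_continuousOn hf).induction_on
    (p := fun s => ∃ δ > 0, ∀ p ∈ s, ∀ i, ∃ φ, FaceSeparator i (f ⁻¹' Metric.ball p δ) δ φ)
    ?_ ?_ ?_ ?_
  · exact ⟨1, one_pos, by simp⟩
  · rintro s t hst ⟨δ, hδ, H⟩
    exact ⟨δ, hδ, fun p hp => H p (hst hp)⟩
  · rintro s t ⟨δ, hδ, H⟩ ⟨ε, hε, H'⟩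
    refine ⟨min δ ε, lt_min hδ hε, fun p hp i => ?_⟩
    rcases hp with hp | hp
    · obtain ⟨φ, hφ⟩ := H p hp i
      exact ⟨φ, hφ.mono (Set.preimage_mono (Metric.ball_subset_ball (min_le_left _ _)))
        (min_le_left _ _)⟩
    · obtain ⟨φ, hφ⟩ := H' p hp i
      exact ⟨φ, hφ.mono (Set.preimage_mono (Metric.ball_subset_ball (min_le_right _ _)))
        (min_le_right _ _)⟩
  · intro p _
    choose δ hδ φ hφ using fun i => exists_faceSeparator_of_fiber hf p i
      (fun S hS hSc hSi => h p S hS hSc ⟨i, hSi⟩)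
    obtain ⟨r, hr, hrδ⟩ : ∃ r > 0, ∀ i, r ≤ δ i := by
      rcases isEmpty_or_nonempty (Fin n) with _ | _
      · exact ⟨1, one_pos, fun i => isEmptyElim i⟩
      · obtain ⟨i, hi⟩ := Finite.exists_min δ
        exact ⟨δ i, hδ i, hi⟩
    refine ⟨Metric.ball p (r / 2), mem_nhdsWithin_of_mem_nhds (Metric.ball_mem_nhds p (half_pos hr)),
      r / 2, half_pos hr, fun q hq i => ⟨φ i, (hφ i).mono (Set.preimage_mono ?_)
        ((half_le_self hr.le).trans (hrδ i))⟩⟩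
    refine Metric.ball_subset_ball' ?_
    have := Metric.mem_ball.1 hq
    have := hrδ i
    linarith

end Fibers

/-! ### Shifted grids and the contradiction -/

theorem floor_eq_floor_of_abs_sub_lt {a b ρ : ℝ} (ha : ∀ k : ℤ, ρ ≤ |a - k|)
    (hab : |a - b| < ρ) : ⌊a⌋ = ⌊b⌋ := by
  have h1 := ha ⌊a⌋
  have h2 := ha (⌊a⌋ + 1)
  have h3 := Int.floor_le a
  have h4 := Int.lt_floor_add_one a
  rw [abs_of_nonneg (by linarith)] at h1
  push_cast at h2
  rw [abs_of_neg (by linarith)] at h2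
  rw [abs_lt] at hab
  exact (Int.floor_eq_iff.2 ⟨by linarith, by linarith⟩).symm

/-- Among the translates of the lattice `ℤ^m` by multiples of `1 / n`, where `m < n`, there is
one whose coordinate hyperplanes are all at distance at least `1 / (2 * n)` from `y`. -/
theorem exists_translate_far_from_integers {n m : ℕ} (hmn : m < n) (y : Fin m → ℝ) :
    ∃ c : Fin n, ∀ (j : Fin m) (k : ℤ), 1 / (2 * n : ℝ) ≤ |y j - (c : ℕ) / n - k| := by
  by_contra! h
  choose j k hjk using h
  have hn : (0 : ℝ) < n := by exact_mod_cast (Nat.zero_le m).trans_lt hmn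
  -- Pigeonhole: distinct shifts differ by at least `1 / n` modulo 1, so one coordinate cannot be
  -- near walls of two grids.
  have hinj : Function.Injective j := by
    intro c d hcd
    have hc := hjk c
    have hd := hjk d
    rw [← hcd] at hd
    have hlt : |((d : ℕ) / n + k d : ℝ) - ((c : ℕ) / n + k c)| < 1 / n := by
      have e : (1 / n : ℝ) = 1 / (2 * n) + 1 / (2 * n) := by field_simp; norm_num
      rw [e]
      rw [abs_lt] at hc hd ⊢
      constructor <;> linarith [hc.1, hc.2, hd.1, hd.2]
    have hint : |((d : ℕ) + n * k d - ((c : ℕ) + n * k c) : ℤ)| < 1 := by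
      have e : ((d : ℕ) + n * k d - ((c : ℕ) + n * k c) : ℝ) =
          n * (((d : ℕ) / n + k d : ℝ) - ((c : ℕ) / n + k c)) := by
        field_simp
      have : |((d : ℕ) + n * k d - ((c : ℕ) + n * k c) : ℝ)| < 1 := by
        rw [e, abs_mul, abs_of_pos hn]
        calc _ < (n : ℝ) * (1 / n) := mul_lt_mul_of_pos_left hlt hn
          _ = 1 := by field_simp
      exact_mod_cast this
    rw [Int.abs_lt_one_iff] at hint
    have hmod : ((d : ℕ) + n * k d : ℤ) % n = ((c : ℕ) + n * k c) % n := by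
      rw [sub_eq_zero.1 hint]
    rw [Int.add_mul_emod_self_left, Int.add_mul_emod_self_left] at hmod
    norm_cast at hmod
    rw [Nat.mod_eq_of_lt d.2, Nat.mod_eq_of_lt c.2] at hmod
    exact Fin.ext hmod.symm
  have := Fintype.card_le_of_injective j hinj
  simp only [Fintype.card_fin] at this
  omega

/-- The point of the lattice of mesh `1 / M` with index `x`, clamped to the unit cube. -/
noncomputable def gridPoint {n : ℕ} (M : ℕ) (x : Fin n → ℕ) : Fin n → ℝ :=
  fun i => (min (x i) M : ℕ) / (M : ℝ)

theorem gridPoint_mem_unitCube {n : ℕ} (M : ℕ) (x : Fin n → ℕ) :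
    gridPoint M x ∈ unitCube n := by
  refine fun i => ⟨by unfold gridPoint; positivity, ?_⟩
  exact div_le_one_of_le₀ (by exact_mod_cast min_le_right _ _) (Nat.cast_nonneg _)

theorem dist_gridPoint_le {n M : ℕ} {x y : Fin n → ℕ}
    (h : ∀ k, x k ≤ y k ∧ y k ≤ x k + 1) :
    dist (gridPoint M x) (gridPoint M y) ≤ 1 / M := by
  refine (dist_pi_le_iff (by positivity)).2 fun k => ?_
  have h1 : min (x k) M ≤ min (y k) M := min_le_min_right _ (h k).1
  have h2 : min (y k) M ≤ min (x k) M + 1 := by have := (h k).2; omega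
  rw [dist_comm, Real.dist_eq, gridPoint, gridPoint, ← sub_div, abs_div, Nat.abs_cast]
  have h1' : ((min (x k) M : ℕ) : ℝ) ≤ (min (y k) M : ℕ) := by exact_mod_cast h1
  have h2' : ((min (y k) M : ℕ) : ℝ) ≤ (min (x k) M : ℕ) + 1 := by exact_mod_cast h2
  gcongr
  rw [abs_of_nonneg (by linarith)]
  linarith

/-- Continuous maps from the `n`-dimensional cube to a space of smaller dimension have a fiber
with a compact connected subset that joins opposite faces. -/
theorem exists_fiber_connectsSomeFaces {n m : ℕ} (hmn : m < n) (f : (Fin n → ℝ) → (Fin m → ℝ))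
    (hf : ContinuousOn f (unitCube n)) :
    ∃ (p : Fin m → ℝ) (S : Set (Fin n → ℝ)),
      IsCompact S ∧ S ⊆ unitCube n ∩ f ⁻¹' {p} ∧ ConnectsSomeFaces n S := by
  by_contra! hcon
  obtain ⟨δ, hδ, hsep⟩ := exists_faceSeparator_uniform hf
    (fun p S hS hSc => hcon p S hSc hS)
  have hn : (0 : ℝ) < n := by exact_mod_cast (Nat.zero_le m).trans_lt hmn
  let cell : Fin n → (Fin m → ℝ) → (Fin m → ℤ) := fun c y j => ⌊y j / δ - (c : ℕ) / n⌋
  have hcell : ∀ c y y', cell c y = cell c y' → dist y y' < δ := by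
    intro c y y' h
    refine (dist_pi_lt_iff hδ).2 fun j => ?_
    have := Int.abs_sub_lt_one_of_floor_eq_floor (congrFun h j)
    rw [sub_sub_sub_cancel_right, ← sub_div, abs_div, abs_of_pos hδ, div_lt_one hδ] at this
    exact this
  have hφ : ∀ c z, ∃ φ, FaceSeparator c {x | x ∈ unitCube n ∧ cell c (f x) = z} δ φ := by
    intro c z
    by_cases hz : ∃ x ∈ unitCube n, cell c (f x) = z
    · obtain ⟨x₀, hx₀, hz⟩ := hz
      obtain ⟨φ, hφ⟩ := hsep (f x₀) ⟨x₀, hx₀, rfl⟩ c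
      exact ⟨φ, hφ.mono (fun x hx => hcell c _ _ (hx.2.trans hz.symm)) le_rfl⟩
    · obtain ⟨φ, hφ⟩ := exists_faceSeparator_empty c δ
      exact ⟨φ, hφ.mono (fun x hx => hz ⟨x, hx⟩) le_rfl⟩
  choose φ hφ using hφ
  have huc := (isCompact_unitCube n).uniformContinuousOn_of_continuous hf
  rw [Metric.uniformContinuousOn_iff] at huc
  obtain ⟨ε, hε, hfε⟩ := huc (δ * (1 / (2 * n))) (by positivity)
  obtain ⟨N, hN⟩ := exists_nat_one_div_lt (lt_min hδ hε)
  set M := N + 1 with hM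
  replace hN : 1 / (M : ℝ) < min δ ε := by rw [hM]; exact_mod_cast hN
  -- Clamping lets the separators be evaluated on all of `ℕ^n`, where the lattice theorem lives.
  have hI : ∀ x, gridPoint M x ∈ unitCube n := gridPoint_mem_unitCube M
  obtain ⟨x, hx⟩ := exists_lattice_cube_forall_ne (ι := Fin n) (M := M)
    (g := fun i x => φ i (cell i (f (gridPoint M x))) (gridPoint M x))
    (fun i x hxi => (hφ i _).lower _ ⟨hI x, by simp [gridPoint, hxi]⟩)
    (fun i x hxi => (hφ i _).upper _ ⟨hI x, by
      simp only [gridPoint, hxi, min_self]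
      exact div_self (by rw [hM]; positivity)⟩)
  obtain ⟨c, hc⟩ := exists_translate_far_from_integers hmn fun j => f (gridPoint M x) j / δ
  have key : ∀ y, (∀ k, x k ≤ y k ∧ y k ≤ x k + 1) →
      φ c (cell c (f (gridPoint M y))) (gridPoint M y) =
        φ c (cell c (f (gridPoint M x))) (gridPoint M x) := by
    intro y hy
    have hd := (dist_gridPoint_le (M := M) hy).trans_lt hN
    have hfd := hfε _ (hI x) _ (hI y) (hd.trans_le (min_le_right _ _))
    -- The modulus of continuity `δ * (1 / (2 * n))`, divided by `δ`, is exactly the clearance from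
    -- the walls of grid `c`.
    have hcell_eq : cell c (f (gridPoint M x)) = cell c (f (gridPoint M y)) := by
      funext j
      refine floor_eq_floor_of_abs_sub_lt (hc j) ?_
      rw [sub_sub_sub_cancel_right, ← sub_div, abs_div, abs_of_pos hδ, div_lt_iff₀' hδ]
      exact (dist_le_pi_dist _ _ j).trans_lt hfd
    rw [← hcell_eq]
    exact ((hφ c _).eq_of_dist_lt _ ⟨hI x, rfl⟩ (hI x) _ (hI y)
      (hd.trans_le (min_le_left _ _))).symm
  obtain ⟨y, z, hy, hz, hyz⟩ := hx c
  exact hyz ((key y hy).trans (key z hz).symm)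

theorem theoremB (n : ℕ) (hn : 1 ≤ n) (f : (Fin n → ℝ) → (Fin (n - 1) → ℝ))
    (hf : ContinuousOn f (unitCube n)) :
    ∃ (p : Fin (n - 1) → ℝ) (S : Set (Fin n → ℝ)),
      IsCompact S ∧ S ⊆ unitCube n ∩ f ⁻¹' {p} ∧ ConnectsSomeFaces n S :=
  exists_fiber_connectsSomeFaces (Nat.sub_lt hn one_pos) f hf
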